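/- Let $\mathbb{H}$ be the quaternions, $\mathbb{IH}=\{q\in\mathbb{H}: \mathrm{Re}\,q=0\}$, and for quaternion-valued 1-forms put $(\phi\wedge\psi)(u,v)=\phi(u)\psi(v)-\phi(v)\psi(u)$. Identify $T^*\mathbb{H}$ with $\mathbb{H}\times\mathbb{H}\ni(z,w)$ and $T^*(\mathbb{IH}\setminus\{0\})$ with $\{(Q,P)\in\mathbb{IH}\times\mathbb{IH}: Q\neq 0\}$ (base point first, fibre second). Let $$\Sigma^1=\{(z,w)\in\mathbb{H}\times\mathbb{H}:\ \mathrm{Re}(\bar z i w)=0,\ z\ne 0\},$$ let $S^1$ act on $\Sigma^1$ by $(z,w)\mapsto(e^{i\vartheta}z,e^{i\vartheta}w)$, and let $\pi:\Sigma^1\to V^1=\Sigma^1/S^1$ be the quotient map. Let $$K.S.(z,w)=(Q,P)=\Big(\bar z i z,\ \frac{\bar z i w}{2|z|^2}\Big)\qquad(z\neq0).$$ Then: 1. $\Sigma^1$ is an embedded smooth submanifold of $\mathbb{H}\times\mathbb{H}$ of dimension 7. With the quotient topology and the atlas of all local homeomorphisms $e$ from $V^1$ to $\mathbb{IH}\times\mathbb{IH}\cong\mathbb{R}^6$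 for which $e\circ\pi$ is a smooth submersion, $V^1$ is a smooth manifold and $\pi$ is a smooth submersion. 2. $(K.S.)^*\,\mathrm{Re}\{d\bar P\wedge dQ\}\,|_{\Sigma^1}=\mathrm{Re}\{d\bar w\wedge dz\}\,|_{\Sigma^1}$. 3. $\mathrm{Re}\{d\bar P\wedge dQ\}$ is a symplectic form on $T^*(\mathbb{IH}\setminus\{0\})$. There is exactly one 2-form $\omega_1$ on $V^1$ with $\pi^*\omega_1=\mathrm{Re}\{d\bar w\wedge dz\}|_{\Sigma^1}$, and it is symplectic (smooth, closed and nondegenerate). 4. $K.S.$ induces a symplectomorphism from $(V^1,\omega_1)$ to $(T^*(\mathbb{IH}\setminus\{0\}),\mathrm{Re}\{d\bar P\wedge dQ\})$: there is a $C^\infty$ diffeomorphism $\Phi:V^1\to T^*(\mathbb{IH}\setminus\{0\})$ with $\Phi(\pi(z,w))=K.S.(z,w)$ for all $(z,w)\in\Sigma^1$ and $\Phi^*\,\mathrm{Re}\{d\bar P\wedge dQ\}=\omega_1$. -/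

import Mathlib

open scoped Manifold ContDiff Quaternion Topology

noncomputable section

namespace KS

/-! ### Two-forms on manifolds -/

section Forms

variable {E H M E' H' M' : Type*}
  [NormedAddCommGroup E] [NormedSpace ℝ E] [TopologicalSpace H]
  [TopologicalSpace M] [ChartedSpace H M]
  [NormedAddCommGroup E'] [NormedSpace ℝ E'] [TopologicalSpace H']
  [TopologicalSpace M'] [ChartedSpace H' M']

/-- A (not necessarily continuous) differential 2-form on a manifold: an alternating bilinear form
on every tangent space. -/
abbrev TwoForm (I : ModelWithCorners ℝ E H) (M : Type*) [TopologicalSpace M] [ChartedSpace H M] :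
    Type _ :=
  ∀ q : M, (TangentSpace I q) [⋀^Fin 2]→L[ℝ] ℝ

/-- The pullback `f^* β`. -/
def pullback (I : ModelWithCorners ℝ E H) (I' : ModelWithCorners ℝ E' H')
    (f : M → M') (β : TwoForm I' M') : TwoForm I M :=
  fun q => (β (f q)).compContinuousLinearMap (mfderiv I I' f q)

/-- The real part of the wedge product of two quaternion-valued linear forms, where
`(φ ∧ ψ)(u, v) = φ u * ψ v - φ v * ψ u`. -/
def reWedge {V : Type*} [AddCommGroup V] [Module ℝ V] [TopologicalSpace V]
    (φ ψ : V →L[ℝ] ℍ) : V [⋀^Fin 2]→L[ℝ] ℝ where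
  toFun v := (φ (v 0) * ψ (v 1) - φ (v 1) * ψ (v 0)).re
  map_update_add' := by
    intro _ m i x y
    fin_cases i <;> simp [mul_add, add_mul] <;> ring
  map_update_smul' := by
    intro _ m i c x
    fin_cases i <;> simp <;> ring
  map_eq_zero_of_eq' := by
    intro v i j h hij
    have h01 : v 0 = v 1 := by
      fin_cases i <;> fin_cases j <;> first | exact absurd rfl hij | exact h | exact h.symm
    simp [h01]
  cont := by
    apply Quaternion.continuous_re.comp
    fun_prop

/-- The 2-form `Re {df ∧ dg}` for quaternion-valued functions `f`, `g` on a manifold. -/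
def reDWedgeD (I : ModelWithCorners ℝ E H) (f g : M → ℍ) : TwoForm I M :=
  fun q => reWedge (mfderiv I 𝓘(ℝ, ℍ) f q : TangentSpace I q →L[ℝ] ℍ)
    (mfderiv I 𝓘(ℝ, ℍ) g q : TangentSpace I q →L[ℝ] ℍ)

/-- The local representation `(e⁻¹)^* β` of a 2-form in a chart `e`, as a differential form on the
model space (meaningful on `e.target`). -/
def localRep {M : Type*} [TopologicalSpace M] [ChartedSpace E M]
    (e : OpenPartialHomeomorph M E) (β : TwoForm 𝓘(ℝ, E) M) : E → E [⋀^Fin 2]→L[ℝ] ℝ :=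
  fun y => pullback 𝓘(ℝ, E) 𝓘(ℝ, E) e.symm β y

/-- A 2-form on a manifold modelled on the normed space `E` is symplectic if it is nondegenerate at
every point and its local representation in every chart of the atlas is smooth and closed. -/
structure IsSymplectic {M : Type*} [TopologicalSpace M] [ChartedSpace E M]
    (β : TwoForm 𝓘(ℝ, E) M) : Prop where
  nondegenerate : ∀ (q : M) (u : TangentSpace 𝓘(ℝ, E) q),
    (∀ v : TangentSpace 𝓘(ℝ, E) q, β q ![u, v] = 0) → u = 0
  smooth : ∀ e ∈ atlas E M, ContDiffOn ℝ ∞ (localRep e β) e.target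
  closed : ∀ e ∈ atlas E M, ∀ y ∈ e.target, extDeriv (localRep e β) y = 0

end Forms

/-! ### The hypersurface, the circle action and the Kustaanheimo-Stiefel mapping -/

/-- The quaternion unit `i`. -/
def qi : ℍ := ⟨0, 1, 0, 0⟩

/-- The space `𝕀ℍ` of purely imaginary quaternions. -/
def ImH : Submodule ℝ ℍ where
  carrier := {q | q.re = 0}
  add_mem' := by
    intro a b ha hb
    change (a + b).re = 0
    rw [Quaternion.re_add, show a.re = 0 from ha, show b.re = 0 from hb, add_zero]
  zero_mem' := by simp
  smul_mem' := by
    intro c a ha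
    change (c • a).re = 0
    rw [Quaternion.re_smul, show a.re = 0 from ha, smul_zero]

/-- The bilinear relation `BL(z, w) = Re {z̄ i w}`. -/
def BL (x : ℍ × ℍ) : ℝ := (star x.1 * qi * x.2).re

/-- `Σ¹ = {BL = 0} ∖ {z = 0}` in `T^*ℍ = ℍ × ℍ`. -/
def Sigma1 : Set (ℍ × ℍ) := {x | BL x = 0 ∧ x.1 ≠ 0}

/-- The Kustaanheimo-Stiefel mapping `(z, w) ↦ (Q, P) = (z̄ i z, z̄ i w / (2 |z|²))`. -/
def ksMap (x : ℍ × ℍ) : ℍ × ℍ :=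
  (star x.1 * qi * x.1, (2 * ‖x.1‖ ^ 2)⁻¹ • (star x.1 * qi * x.2))

/-- `T^*(𝕀ℍ ∖ {0})`, identified with the open subset `{(Q, P) | Q ≠ 0}` of `𝕀ℍ × 𝕀ℍ`. -/
def TStar : TopologicalSpace.Opens (ImH × ImH) :=
  ⟨{x | x.1 ≠ 0}, isOpen_ne.preimage continuous_fst⟩

/-- The coordinate `Q` on `T^*(𝕀ℍ ∖ {0})`. -/
def coordQ (x : TStar) : ℍ := (x.1.1 : ℍ)

/-- The coordinate `P` on `T^*(𝕀ℍ ∖ {0})`. -/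
def coordP (x : TStar) : ℍ := (x.1.2 : ℍ)

@[simp] lemma qi_re : qi.re = 0 := rfl

@[simp] lemma qi_imI : qi.imI = 1 := rfl

@[simp] lemma qi_imJ : qi.imJ = 0 := rfl

@[simp] lemma qi_imK : qi.imK = 0 := rfl

lemma norm_qi : ‖qi‖ = 1 := by
  have h : ‖qi‖ * ‖qi‖ = 1 := by
    rw [← Quaternion.normSq_eq_norm_mul_self, Quaternion.normSq_def']
    simp
  nlinarith [norm_nonneg qi]

lemma qi_mul_qi : qi * qi = -1 := by
  ext <;> simp

lemma star_qi : star qi = -qi := by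
  ext <;> simp

lemma star_mul_self' (z : ℍ) : star z * z = ((‖z‖ ^ 2 : ℝ) : ℍ) := by
  rw [Quaternion.star_mul_self, Quaternion.normSq_eq_norm_mul_self, sq]

lemma mul_star_self' (z : ℍ) : z * star z = ((‖z‖ ^ 2 : ℝ) : ℍ) := by
  rw [Quaternion.self_mul_star, Quaternion.normSq_eq_norm_mul_self, sq]

/-- The inclusion of the circle into the quaternions, `e^{iθ} ↦ cos θ + i sin θ`. -/
def circleToH (a : Circle) : ℍ := ((a : ℂ) : ℍ)

lemma circleToH_mul (a b : Circle) : circleToH (a * b) = circleToH a * circleToH b := by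
  simp [circleToH]

lemma star_circleToH_mul (a : Circle) : star (circleToH a) * qi * circleToH a = qi := by
  have h : (a : ℂ).re * (a : ℂ).re + (a : ℂ).im * (a : ℂ).im = 1 := by
    have := Circle.normSq_coe a
    rwa [Complex.normSq_apply] at this
  ext
  · simp [circleToH]; ring
  · simp [circleToH]; linarith
  · simp [circleToH]
  · simp [circleToH]

lemma circleToH_ne_zero (a : Circle) : circleToH a ≠ 0 := by
  intro h
  have := star_circleToH_mul a
  rw [h] at this
  have h2 := norm_qi
  rw [← this] at h2
  simp at h2

lemma star_smul_mul (a : Circle) (z w : ℍ) :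
    star (circleToH a * z) * qi * (circleToH a * w) = star z * qi * w := by
  rw [star_mul]
  calc _ = star z * (star (circleToH a) * qi * circleToH a) * w := by simp only [mul_assoc]
    _ = _ := by rw [star_circleToH_mul]

/-- The circle action `(z, w) ↦ (e^{iθ} z, e^{iθ} w)` on `Σ¹`. -/
instance : MulAction Circle Sigma1 where
  smul a x := ⟨(circleToH a * x.1.1, circleToH a * x.1.2),
    by
      have := x.2.1
      simp only [BL] at this ⊢
      rw [star_smul_mul]
      exact this,
    mul_ne_zero (circleToH_ne_zero a) x.2.2⟩
  one_smul x := by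
    apply Subtype.ext
    change (circleToH 1 * x.1.1, circleToH 1 * x.1.2) = x.1
    simp [circleToH]
  mul_smul a b x := by
    apply Subtype.ext
    change (circleToH (a * b) * x.1.1, circleToH (a * b) * x.1.2) =
      (circleToH a * (circleToH b * x.1.1), circleToH a * (circleToH b * x.1.2))
    simp [circleToH_mul, mul_assoc]

/-- The reduced space `V¹ = Σ¹ / S¹`. -/
def V1 : Type := MulAction.orbitRel.Quotient Circle Sigma1

/-- The projection `Σ¹ → V¹`. -/
def proj : Sigma1 → V1 := Quotient.mk (MulAction.orbitRel Circle Sigma1)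

/-- `V¹` carries the quotient topology. -/
instance : TopologicalSpace V1 := TopologicalSpace.coinduced proj inferInstance

/-! ### The smooth structure of `Σ¹` -/

lemma mem_ImH {q : ℍ} : q ∈ ImH ↔ q.re = 0 := Iff.rfl

lemma star_mul_qi_mul_inv {z : ℍ} (hz : z ≠ 0) (y : ℍ) :
    star z * qi * (-((‖z‖ ^ 2)⁻¹ • (qi * z * y))) = y := by
  have hz' : ‖z‖ ^ 2 ≠ 0 := pow_ne_zero 2 (norm_ne_zero_iff.2 hz)
  calc _ = -((‖z‖ ^ 2)⁻¹ • (star z * (qi * qi) * z * y)) := by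
        simp only [mul_neg, mul_smul_comm, mul_assoc]
    _ = (‖z‖ ^ 2)⁻¹ • ((star z * z) * y) := by rw [qi_mul_qi]; simp
    _ = y := by
      rw [star_mul_self', Quaternion.coe_mul_eq_smul, smul_smul, inv_mul_cancel₀ hz', one_smul]

lemma inv_star_mul_qi_mul {z : ℍ} (hz : z ≠ 0) (w : ℍ) :
    -((‖z‖ ^ 2)⁻¹ • (qi * z * (star z * qi * w))) = w := by
  have hz' : ‖z‖ ^ 2 ≠ 0 := pow_ne_zero 2 (norm_ne_zero_iff.2 hz)
  calc _ = -((‖z‖ ^ 2)⁻¹ • (qi * (z * star z) * qi * w)) := by simp only [mul_assoc]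
    _ = -((‖z‖ ^ 2)⁻¹ • ((‖z‖ ^ 2) • (qi * qi * w))) := by
      rw [mul_star_self', ← Quaternion.coe_commutes, Quaternion.coe_mul_eq_smul,
        smul_mul_assoc, smul_mul_assoc]
    _ = w := by
      rw [smul_smul, inv_mul_cancel₀ hz', one_smul, qi_mul_qi]; simp

lemma mem_Sigma1_of {z y : ℍ} (hz : z ≠ 0) (hy : y ∈ ImH) :
    (z, -((‖z‖ ^ 2)⁻¹ • (qi * z * y))) ∈ Sigma1 := by
  refine ⟨?_, hz⟩
  rw [BL]
  simp only
  rw [star_mul_qi_mul_inv hz]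
  exact hy

lemma base_mem : ((1, 0) : ℍ × ℍ) ∈ Sigma1 := by
  refine ⟨by simp [BL], by simp⟩

open Classical in
/-- The global chart `(z, w) ↦ (z, z̄ i w)` of `Σ¹`, with image the open set `{z ≠ 0}` of
`ℍ × 𝕀ℍ`. -/
def sigmaChart : OpenPartialHomeomorph Sigma1 (ℍ × ImH) where
  toFun x := (x.1.1, ⟨star x.1.1 * qi * x.1.2, x.2.1⟩)
  invFun u := if h : u.1 ≠ 0 then ⟨_, mem_Sigma1_of h u.2.2⟩ else ⟨_, base_mem⟩
  source := Set.univ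
  target := {u | u.1 ≠ 0}
  map_source' := fun x _ => x.2.2
  map_target' := fun _ _ => trivial
  left_inv' := by
    intro x _
    apply Subtype.ext
    rw [dif_pos x.2.2]
    exact Prod.ext rfl (inv_star_mul_qi_mul x.2.2 _)
  right_inv' := by
    intro u hu
    have hu' : u.1 ≠ 0 := hu
    simp only [dif_pos hu']
    exact Prod.ext rfl (Subtype.ext (star_mul_qi_mul_inv hu' _))
  open_source := isOpen_univ
  open_target := isOpen_ne.preimage continuous_fst
  continuousOn_toFun := by
    apply Continuous.continuousOn
    fun_prop
  continuousOn_invFun := by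
    rw [continuousOn_iff_continuous_domRestrict, continuous_induced_rng]
    have : (Subtype.val ∘ Set.domRestrict {u : ℍ × ImH | u.1 ≠ 0} fun u : ℍ × ImH =>
        (if h : u.1 ≠ 0 then (⟨_, mem_Sigma1_of h u.2.2⟩ : Sigma1) else ⟨_, base_mem⟩)) =
        fun u => (u.1.1, -((‖u.1.1‖ ^ 2)⁻¹ • (qi * u.1.1 * (u.1.2 : ℍ)))) := by
      funext u
      have hu : u.1.1 ≠ 0 := u.2
      simp only [Function.comp_apply, Set.domRestrict_apply, dif_pos hu]
    rw [this]
    have h2 : ∀ u : {u : ℍ × ImH | u.1 ≠ 0}, ‖u.1.1‖ ^ 2 ≠ 0 :=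
      fun u => pow_ne_zero 2 (norm_ne_zero_iff.2 u.2)
    have h3 : Continuous fun u : {u : ℍ × ImH | u.1 ≠ 0} => (‖u.1.1‖ ^ 2)⁻¹ :=
      Continuous.inv₀ (by fun_prop) h2
    fun_prop

instance : ChartedSpace (ℍ × ImH) Sigma1 := sigmaChart.singletonChartedSpace rfl

instance : IsManifold 𝓘(ℝ, ℍ × ImH) ∞ Sigma1 := sigmaChart.isManifold_singleton rfl

/-! ### The smooth structure of `V¹` -/

/-- The smooth quotient structure on `V¹`: the local homeomorphisms from `V¹` to the model space
whose composition with the projection `Σ¹ → V¹` is a smooth submersion. -/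
def quotientAtlas : Set (OpenPartialHomeomorph V1 (ImH × ImH)) :=
  {e | ∀ p : Sigma1, proj p ∈ e.source →
    ContMDiffAt 𝓘(ℝ, ℍ × ImH) 𝓘(ℝ, ImH × ImH) ∞ (fun x => e (proj x)) p ∧
    Function.Surjective
      (mfderiv 𝓘(ℝ, ℍ × ImH) 𝓘(ℝ, ImH × ImH) (fun x => e (proj x)) p)}

/-! The remaining facts show that every point of `V¹` lies in the domain of such a chart. -/

lemma hopf_mem (z : ℍ) : star z * qi * z ∈ ImH := by
  rw [mem_ImH]
  simp
  ring

lemma norm_hopf (z : ℍ) : ‖star z * qi * z‖ = ‖z‖ ^ 2 := by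
  rw [norm_mul, norm_mul, norm_star, norm_qi]
  ring

/-- The map `(z, y) ↦ (z̄ i z, y / (2 |z|²))`. -/
def ksCoord (u : ℍ × ImH) : ImH × ImH :=
  (⟨star u.1 * qi * u.1, hopf_mem u.1⟩, (2 * ‖u.1‖ ^ 2)⁻¹ • u.2)

/-- The restriction of the Kustaanheimo-Stiefel mapping to `Σ¹`. -/
def ksSigma (p : Sigma1) : ImH × ImH := ksCoord (sigmaChart p)

lemma contDiff_codRestrict {f : ℍ → ℍ} (hf : ContDiff ℝ ∞ f) (h : ∀ x, f x ∈ ImH) :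
    ContDiff ℝ ∞ (fun x => (⟨f x, h x⟩ : ImH)) := by
  have : (fun x => (⟨f x, h x⟩ : ImH)) = fun x => ImH.orthogonalProjectionOnto (f x) := by
    funext x
    exact (Submodule.orthogonalProjectionOnto_mem_subspace_eq_self (K := ImH) ⟨f x, h x⟩).symm
  rw [this]
  exact (ContinuousLinearMap.contDiff _).comp hf

lemma contDiff_star : ContDiff ℝ ∞ (fun z : ℍ => star z) :=
  (LinearMap.toContinuousLinearMap
    { toFun := fun z : ℍ => star z
      map_add' := star_add
      map_smul' := Quaternion.star_smul }).contDiff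

lemma contDiffAt_ksCoord {u : ℍ × ImH} (hu : u.1 ≠ 0) : ContDiffAt ℝ ∞ ksCoord u := by
  apply ContDiffAt.prodMk
  · have h : ContDiff ℝ ∞ (fun z : ℍ => star z * qi * z) :=
      (contDiff_star.mul contDiff_const).mul contDiff_id
    exact ((contDiff_codRestrict h hopf_mem).comp contDiff_fst).contDiffAt
  · refine ContDiffAt.fun_smul ?_ contDiffAt_snd
    apply ContDiffAt.inv
    · exact contDiffAt_const.mul ((contDiff_norm_sq ℝ).comp contDiff_fst).contDiffAt
    · have := norm_ne_zero_iff.2 hu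
      positivity

/-- An auxiliary local section of `z ↦ z̄ i z`. -/
def secAux (z₀ Q : ℍ) : ℍ := z₀ - ‖Q‖⁻¹ • (qi * z₀ * Q)

/-- A local section of `z ↦ z̄ i z` through `z₀`. -/
def sec (z₀ Q : ℍ) : ℍ := (√‖Q‖ * ‖secAux z₀ Q‖⁻¹) • secAux z₀ Q

lemma qi_mul_hopf (z : ℍ) : z * (star z * qi * z) = (‖z‖ ^ 2) • (qi * z) := by
  calc _ = (z * star z) * qi * z := by simp only [mul_assoc]
    _ = _ := by rw [mul_star_self', Quaternion.coe_mul_eq_smul, smul_mul_assoc]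

lemma ImH_mul_self {Q : ℍ} (hQ : Q ∈ ImH) : Q * Q = -(((‖Q‖ ^ 2 : ℝ)) : ℍ) := by
  have : star Q = -Q := Quaternion.star_eq_neg.2 hQ
  rw [← star_mul_self', this]
  simp

lemma secAux_mul {z₀ Q : ℍ} (hQ : Q ∈ ImH) (hQ0 : Q ≠ 0) :
    secAux z₀ Q * Q = ‖Q‖ • (qi * secAux z₀ Q) := by
  have hn : ‖Q‖ ≠ 0 := norm_ne_zero_iff.2 hQ0
  have h1 : qi * z₀ * Q * Q = -((‖Q‖ ^ 2) • (qi * z₀)) := by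
    rw [mul_assoc _ Q Q, ImH_mul_self hQ, mul_neg, ← Quaternion.coe_commutes,
      Quaternion.coe_mul_eq_smul]
  have h2 : qi * (qi * z₀ * Q) = -(z₀ * Q) := by
    rw [← mul_assoc, ← mul_assoc, qi_mul_qi]
    simp
  rw [secAux, sub_mul, smul_mul_assoc, h1, mul_sub, mul_smul_comm, h2, smul_sub, smul_smul,
    mul_inv_cancel₀ hn, smul_neg, smul_smul]
  have h3 : ‖Q‖⁻¹ * ‖Q‖ ^ 2 = ‖Q‖ := by field_simp
  rw [h3]
  simp
  abel

lemma hopf_of_mul {z Q : ℍ} (hQ : Q ≠ 0) (h : z * Q = ‖Q‖ • (qi * z)) :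
    star z * qi * z = (‖Q‖⁻¹ * ‖z‖ ^ 2) • Q := by
  have hn : ‖Q‖ ≠ 0 := norm_ne_zero_iff.2 hQ
  have h1 : qi * z = ‖Q‖⁻¹ • (z * Q) := by
    rw [h, smul_smul, inv_mul_cancel₀ hn, one_smul]
  rw [mul_assoc, h1, mul_smul_comm, ← mul_assoc, star_mul_self', Quaternion.coe_mul_eq_smul,
    smul_smul]

lemma hopf_sec {z₀ Q : ℍ} (hQ : Q ∈ ImH) (hQ0 : Q ≠ 0) (ha : secAux z₀ Q ≠ 0) :
    star (sec z₀ Q) * qi * sec z₀ Q = Q := by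
  have hn : ‖Q‖ ≠ 0 := norm_ne_zero_iff.2 hQ0
  have ha' : ‖secAux z₀ Q‖ ≠ 0 := norm_ne_zero_iff.2 ha
  rw [sec, Quaternion.star_smul, smul_mul_assoc, smul_mul_assoc, mul_smul_comm,
    hopf_of_mul hQ0 (secAux_mul hQ hQ0), smul_smul, smul_smul]
  have h1 : √‖Q‖ * √‖Q‖ = ‖Q‖ := Real.mul_self_sqrt (norm_nonneg _)
  have h2 : √‖Q‖ * ‖secAux z₀ Q‖⁻¹ * (√‖Q‖ * ‖secAux z₀ Q‖⁻¹) *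
      (‖Q‖⁻¹ * ‖secAux z₀ Q‖ ^ 2) = 1 := by
    calc _ = (√‖Q‖ * √‖Q‖) * ‖Q‖⁻¹ * (‖secAux z₀ Q‖⁻¹ * ‖secAux z₀ Q‖) ^ 2 := by ring
      _ = 1 := by rw [h1, mul_inv_cancel₀ hn, inv_mul_cancel₀ ha']; simp
  rw [h2, one_smul]

lemma secAux_self {z₀ : ℍ} (hz : z₀ ≠ 0) : secAux z₀ (star z₀ * qi * z₀) = (2 : ℝ) • z₀ := by
  have hn : ‖z₀‖ ^ 2 ≠ 0 := pow_ne_zero 2 (norm_ne_zero_iff.2 hz)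
  rw [secAux, norm_hopf, mul_assoc qi, qi_mul_hopf, mul_smul_comm, smul_smul,
    inv_mul_cancel₀ hn, one_smul, ← mul_assoc, qi_mul_qi, two_smul]
  simp

lemma sec_self {z₀ : ℍ} (hz : z₀ ≠ 0) : sec z₀ (star z₀ * qi * z₀) = z₀ := by
  have hn : ‖z₀‖ ≠ 0 := norm_ne_zero_iff.2 hz
  rw [sec, secAux_self hz, norm_hopf, Real.sqrt_sq (norm_nonneg _), norm_smul, smul_smul]
  have : ‖z₀‖ * (‖(2 : ℝ)‖ * ‖z₀‖)⁻¹ * 2 = 1 := by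
    simp
    field_simp
  rw [this, one_smul]

lemma contDiffAt_secAux {z₀ Q : ℍ} (hQ : Q ≠ 0) : ContDiffAt ℝ ∞ (secAux z₀) Q := by
  apply contDiffAt_const.sub
  apply ContDiffAt.fun_smul
  · exact (contDiffAt_norm ℝ hQ).inv (norm_ne_zero_iff.2 hQ)
  · exact contDiffAt_const.mul contDiffAt_id

lemma contDiffAt_sec {z₀ : ℍ} (hz : z₀ ≠ 0) :
    ContDiffAt ℝ ∞ (sec z₀) (star z₀ * qi * z₀) := by
  have hQ : star z₀ * qi * z₀ ≠ 0 := by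
    rw [← norm_ne_zero_iff, norm_hopf]
    exact pow_ne_zero 2 (norm_ne_zero_iff.2 hz)
  have ha : secAux z₀ (star z₀ * qi * z₀) ≠ 0 := by
    rw [secAux_self hz]
    exact smul_ne_zero two_ne_zero hz
  have h := contDiffAt_secAux (z₀ := z₀) hQ
  refine ContDiffAt.fun_smul ?_ h
  apply ContDiffAt.mul
  · exact (contDiffAt_norm ℝ hQ).sqrt (norm_ne_zero_iff.2 hQ)
  · exact (h.norm ℝ ha).inv (norm_ne_zero_iff.2 ha)

/-- A local section of `ksCoord`. -/
def secCoord (z₀ : ℍ) (x : ImH × ImH) : ℍ × ImH :=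
  (sec z₀ x.1, (2 * ‖sec z₀ x.1‖ ^ 2) • x.2)

lemma secCoord_self {u : ℍ × ImH} (hu : u.1 ≠ 0) : secCoord u.1 (ksCoord u) = u := by
  have hn : ‖u.1‖ ≠ 0 := norm_ne_zero_iff.2 hu
  have h : sec u.1 ((ksCoord u).1 : ℍ) = u.1 := sec_self hu
  rw [secCoord, h, ksCoord]
  refine Prod.ext rfl ?_
  simp only [smul_smul]
  rw [mul_inv_cancel₀ (by positivity), one_smul]

lemma contDiffAt_secCoord {u : ℍ × ImH} (hu : u.1 ≠ 0) :
    ContDiffAt ℝ ∞ (secCoord u.1) (ksCoord u) := by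
  have h1 : ContDiffAt ℝ ∞ (fun x : ImH × ImH => sec u.1 (x.1 : ℍ)) (ksCoord u) :=
    ContDiffAt.comp (g := sec u.1) (f := fun x : ImH × ImH => (x.1 : ℍ)) (ksCoord u)
      (contDiffAt_sec hu) ((ImH.subtypeL.contDiff.comp contDiff_fst).contDiffAt)
  exact h1.prodMk ((contDiffAt_const.mul (h1.norm_sq ℝ)).fun_smul contDiffAt_snd)

lemma ksCoord_secCoord {u : ℍ × ImH} (hu : u.1 ≠ 0) :
    ∀ᶠ x in 𝓝 (ksCoord u), ksCoord (secCoord u.1 x) = x := by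
  have hQ : star u.1 * qi * u.1 ≠ 0 := by
    rw [← norm_ne_zero_iff, norm_hopf]
    exact pow_ne_zero 2 (norm_ne_zero_iff.2 hu)
  have ha : secAux u.1 (star u.1 * qi * u.1) ≠ 0 := by
    rw [secAux_self hu]
    exact smul_ne_zero two_ne_zero hu
  have hc : ContinuousAt (fun x : ImH × ImH => (x.1 : ℍ)) (ksCoord u) := by fun_prop
  have e1 : ∀ᶠ x in 𝓝 (ksCoord u), (x.1 : ℍ) ≠ 0 := hc.eventually_ne hQ
  have hc2 : ContinuousAt (fun x : ImH × ImH => secAux u.1 (x.1 : ℍ)) (ksCoord u) :=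
    ContinuousAt.comp (g := secAux u.1) (f := fun x : ImH × ImH => (x.1 : ℍ))
      (contDiffAt_secAux hQ).continuousAt hc
  have e2 : ∀ᶠ x in 𝓝 (ksCoord u), secAux u.1 (x.1 : ℍ) ≠ 0 := hc2.eventually_ne ha
  filter_upwards [e1, e2] with x h1 h2
  have h := hopf_sec x.1.2 h1 h2
  refine Prod.ext (Subtype.ext h) ?_
  have hn : ‖sec u.1 (x.1 : ℍ)‖ ≠ 0 := by
    intro h0
    rw [norm_eq_zero.1 h0] at h
    simp at h
    exact h1 (by rw [← h])
  simp only [ksCoord, secCoord, smul_smul]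
  rw [inv_mul_cancel₀ (by positivity), one_smul]

lemma sigmaChart_ne (p : Sigma1) : (sigmaChart p).1 ≠ 0 := p.2.2

lemma contMDiff_ksSigma : ContMDiff 𝓘(ℝ, ℍ × ImH) 𝓘(ℝ, ImH × ImH) ∞ ksSigma := by
  intro p
  have h1 : ContMDiffAt 𝓘(ℝ, ℍ × ImH) 𝓘(ℝ, ℍ × ImH) ∞ sigmaChart p :=
    contMDiffAt_of_mem_maximalAtlas
      (IsManifold.subset_maximalAtlas (Set.mem_singleton sigmaChart)) (Set.mem_univ p)
  exact (contDiffAt_ksCoord (sigmaChart_ne p)).contMDiffAt.comp p h1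

/-- A local section of `ksSigma` through `p`. -/
def secSigma (p : Sigma1) (x : ImH × ImH) : Sigma1 :=
  sigmaChart.symm (secCoord (sigmaChart p).1 x)

lemma secSigma_self (p : Sigma1) : secSigma p (ksSigma p) = p := by
  rw [secSigma, ksSigma, secCoord_self (sigmaChart_ne p)]
  exact sigmaChart.left_inv (Set.mem_univ p)

lemma contMDiffAt_secSigma (p : Sigma1) :
    ContMDiffAt 𝓘(ℝ, ImH × ImH) 𝓘(ℝ, ℍ × ImH) ∞ (secSigma p) (ksSigma p) := by
  have h2 : ContMDiffAt 𝓘(ℝ, ℍ × ImH) 𝓘(ℝ, ℍ × ImH) ∞ sigmaChart.symm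
      (secCoord (sigmaChart p).1 (ksSigma p)) := by
    apply contMDiffAt_symm_of_mem_maximalAtlas
      (IsManifold.subset_maximalAtlas (Set.mem_singleton sigmaChart))
    rw [ksSigma, secCoord_self (sigmaChart_ne p)]
    exact sigmaChart_ne p
  exact h2.comp _ (contDiffAt_secCoord (sigmaChart_ne p)).contMDiffAt

lemma ksSigma_secSigma (p : Sigma1) :
    ∀ᶠ x in 𝓝 (ksSigma p), ksSigma (secSigma p x) = x := by
  have h0 : ContinuousAt (secCoord (sigmaChart p).1) (ksSigma p) :=
    (contDiffAt_secCoord (sigmaChart_ne p)).continuousAt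
  have h1 : ∀ᶠ x in 𝓝 (ksSigma p), secCoord (sigmaChart p).1 x ∈ sigmaChart.target := by
    apply h0.eventually_mem
    apply sigmaChart.open_target.mem_nhds
    rw [ksSigma, secCoord_self (sigmaChart_ne p)]
    exact sigmaChart_ne p
  filter_upwards [h1, ksCoord_secCoord (sigmaChart_ne p)] with x hx hx2
  rw [ksSigma, secSigma, sigmaChart.right_inv hx]
  exact hx2

lemma surjective_mfderiv_ksSigma (p : Sigma1) : Function.Surjective
    (mfderiv 𝓘(ℝ, ℍ × ImH) 𝓘(ℝ, ImH × ImH) ksSigma p) := by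
  have hs : MDifferentiableAt 𝓘(ℝ, ImH × ImH) 𝓘(ℝ, ℍ × ImH) (secSigma p) (ksSigma p) :=
    (contMDiffAt_secSigma p).mdifferentiableAt (by simp)
  have hk : MDifferentiableAt 𝓘(ℝ, ℍ × ImH) 𝓘(ℝ, ImH × ImH) ksSigma (secSigma p (ksSigma p)) :=
    (contMDiff_ksSigma _).mdifferentiableAt (by simp)
  have h := mfderiv_comp (ksSigma p) hk hs
  have h2 : mfderiv 𝓘(ℝ, ImH × ImH) 𝓘(ℝ, ImH × ImH) (ksSigma ∘ secSigma p) (ksSigma p) =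
      ContinuousLinearMap.id ℝ _ := by
    have h4 : (ksSigma ∘ secSigma p) =ᶠ[𝓝 (ksSigma p)] id := ksSigma_secSigma p
    exact h4.mfderiv_eq.trans mfderiv_id
  intro v
  rw [← secSigma_self p]
  refine ⟨mfderiv 𝓘(ℝ, ImH × ImH) 𝓘(ℝ, ℍ × ImH) (secSigma p) (ksSigma p) v, ?_⟩
  have h3 := congrArg (fun L => L v) (h.symm.trans h2)
  exact h3

lemma isOpenMap_ksSigma : IsOpenMap ksSigma := by
  rw [isOpenMap_iff_nhds_le]
  intro p U hU
  have hc : Filter.Tendsto (secSigma p) (𝓝 (ksSigma p)) (𝓝 p) := by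
    have := (contMDiffAt_secSigma p).continuousAt.tendsto
    rwa [secSigma_self] at this
  have hU' : ∀ᶠ x in 𝓝 (ksSigma p), ksSigma (secSigma p x) ∈ U := hc.eventually hU
  filter_upwards [hU', ksSigma_secSigma p] with x h1 h2
  rwa [h2] at h1

lemma ksSigma_smul (a : Circle) (p : Sigma1) : ksSigma (a • p) = ksSigma p := by
  have hn : ‖circleToH a‖ = 1 := by
    have := congrArg norm (star_circleToH_mul a)
    rw [norm_hopf, norm_qi] at this
    have h0 := norm_nonneg (circleToH a)
    nlinarith
  refine Prod.ext (Subtype.ext ?_) (Subtype.ext ?_)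
  · exact star_smul_mul a _ _
  · change (2 * ‖circleToH a * p.1.1‖ ^ 2)⁻¹ •
        (star (circleToH a * p.1.1) * qi * (circleToH a * p.1.2)) =
      (2 * ‖p.1.1‖ ^ 2)⁻¹ • (star p.1.1 * qi * p.1.2)
    rw [star_smul_mul, norm_mul, hn, one_mul]

lemma exists_smul_of_ksSigma_eq {p p' : Sigma1} (h : ksSigma p = ksSigma p') :
    ∃ a : Circle, a • p = p' := by
  obtain ⟨⟨z, w⟩, hb, hz⟩ := p
  obtain ⟨⟨z', w'⟩, hb', hz'⟩ := p'
  have h1 : star z * qi * z = star z' * qi * z' :=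
    congrArg (fun x : ImH × ImH => (x.1 : ℍ)) h
  have h2 : (2 * ‖z‖ ^ 2)⁻¹ • (star z * qi * w) = (2 * ‖z'‖ ^ 2)⁻¹ • (star z' * qi * w') :=
    congrArg (fun x : ImH × ImH => (x.2 : ℍ)) h
  simp only at hz hz'
  have hn : ‖z‖ ^ 2 = ‖z'‖ ^ 2 := by rw [← norm_hopf, ← norm_hopf, h1]
  have hn' : ‖z‖ = ‖z'‖ := by
    rwa [sq_eq_sq₀ (norm_nonneg _) (norm_nonneg _)] at hn
  have hzn : ‖z‖ ≠ 0 := norm_ne_zero_iff.2 hz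
  have h3 : star z * qi * w = star z' * qi * w' := by
    rw [← hn] at h2
    exact smul_right_injective ℍ (inv_ne_zero (by positivity : 2 * ‖z‖ ^ 2 ≠ 0)) h2
  set u : ℍ := z' * z⁻¹ with hu
  have huz : u * z = z' := by rw [hu, mul_assoc, inv_mul_cancel₀ hz, mul_one]
  have hcomm : u * qi = qi * u := by
    have e1 : z' * (star z * qi * z) = (‖z‖ ^ 2) • (qi * z') := by
      rw [h1, qi_mul_hopf, hn]
    have e2 : z' * (star z * qi * z) = (‖z‖ ^ 2) • (u * qi * z) := by
      calc z' * (star z * qi * z) = u * (z * (star z * qi * z)) := by rw [← huz, mul_assoc]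
        _ = (‖z‖ ^ 2) • (u * (qi * z)) := by rw [qi_mul_hopf, mul_smul_comm]
        _ = _ := by rw [mul_assoc u]
    have e3 : u * qi * z = qi * z' :=
      smul_right_injective ℍ (pow_ne_zero 2 hzn) (e2.symm.trans e1)
    rw [← huz, ← mul_assoc] at e3
    exact mul_right_cancel₀ hz e3
  have hJ : u.imJ = 0 := by
    have := congrArg (fun q : ℍ => q.imK) hcomm
    simp at this
    linarith
  have hK : u.imK = 0 := by
    have := congrArg (fun q : ℍ => q.imJ) hcomm
    simp at this
    linarith
  have hun : ‖u‖ = 1 := by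
    rw [hu, norm_mul, norm_inv, ← hn', mul_inv_cancel₀ hzn]
  have hc : ((⟨u.re, u.imI⟩ : ℂ) : ℍ) = u := by
    ext <;> simp [hJ, hK]
  have hcn : ‖(⟨u.re, u.imI⟩ : ℂ)‖ = 1 := by
    have e : u.re * u.re + u.imI * u.imI = 1 := by
      have := Quaternion.normSq_eq_norm_mul_self u
      rw [hun, Quaternion.normSq_def', hJ, hK] at this
      nlinarith
    rw [Complex.norm_def, Complex.normSq_apply, e, Real.sqrt_one]
  let a : Circle := ⟨⟨u.re, u.imI⟩, by rw [Submonoid.unitSphere, ← SetLike.mem_coe]; simp [hcn]⟩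
  have ha : circleToH a = u := hc
  have haw : circleToH a * w = w' := by
    have e1 := star_smul_mul a z w
    rw [ha, huz, h3] at e1
    have hne : star z' * qi ≠ 0 := by
      rw [← norm_ne_zero_iff, norm_mul, norm_star, norm_qi, mul_one]
      exact norm_ne_zero_iff.2 hz'
    rw [ha]
    exact mul_left_cancel₀ hne e1
  refine ⟨a, Subtype.ext (Prod.ext ?_ haw)⟩
  change circleToH a * z = z'
  rw [ha, huz]

/-- The map induced on `V¹` by the Kustaanheimo-Stiefel mapping. -/
def ksQuot : V1 → ImH × ImH :=
  Quotient.lift ksSigma (by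
    rintro p p' ⟨a, rfl⟩
    exact ksSigma_smul a p')

lemma isOpenEmbedding_ksQuot : Topology.IsOpenEmbedding ksQuot := by
  apply Topology.IsOpenEmbedding.of_continuous_injective_isOpenMap
  · exact continuous_coinduced_dom.2 contMDiff_ksSigma.continuous
  · intro q q'
    refine Quotient.inductionOn₂ q q' ?_
    intro p p' h
    obtain ⟨a, ha⟩ := exists_smul_of_ksSigma_eq (h : ksSigma p = ksSigma p')
    exact (Quotient.sound ⟨a, ha⟩ : proj p' = proj p).symm
  · intro U hU
    have h : ksQuot '' U = ksSigma '' (proj ⁻¹' U) := by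
      ext x
      constructor
      · rintro ⟨q, hq, rfl⟩
        induction q using Quotient.inductionOn with
        | h p => exact ⟨p, hq, rfl⟩
      · rintro ⟨p, hp, rfl⟩
        exact ⟨proj p, hp, rfl⟩
    rw [h]
    exact isOpenMap_ksSigma _ (isOpen_coinduced.1 hU)

instance : Nonempty V1 := ⟨proj ⟨_, base_mem⟩⟩

lemma exists_mem_quotientAtlas (q : V1) : ∃ e ∈ quotientAtlas, q ∈ e.source :=
  ⟨isOpenEmbedding_ksQuot.toOpenPartialHomeomorph ksQuot,
    fun p _ => ⟨contMDiff_ksSigma p, surjective_mfderiv_ksSigma p⟩, Set.mem_univ q⟩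

instance : ChartedSpace (ImH × ImH) V1 where
  atlas := quotientAtlas
  chartAt q := (exists_mem_quotientAtlas q).choose
  mem_chart_source q := (exists_mem_quotientAtlas q).choose_spec.2
  chart_mem_atlas q := (exists_mem_quotientAtlas q).choose_spec.1

/-! ### The differential forms -/

/-- The canonical symplectic form `Re {dw̄ ∧ dz}` of `T^*ℍ = ℍ × ℍ`, where `(z, w)` are the
coordinates (base point first, then fibre). With the coordinates called `(Q, P)` this is
`Re {dP̄ ∧ dQ}`. -/
def formH : TwoForm 𝓘(ℝ, ℍ × ℍ) (ℍ × ℍ) :=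
  reDWedgeD 𝓘(ℝ, ℍ × ℍ) (fun x => star x.2) (fun x => x.1)

/-- The restriction of `Re {dw̄ ∧ dz}` to `Σ¹`. -/
def formSigma : TwoForm 𝓘(ℝ, ℍ × ImH) Sigma1 :=
  pullback 𝓘(ℝ, ℍ × ImH) 𝓘(ℝ, ℍ × ℍ) (Subtype.val : Sigma1 → ℍ × ℍ) formH

/-- The canonical symplectic form `Re {dP̄ ∧ dQ}` of `T^*(𝕀ℍ ∖ {0})`. -/
def formTStar : TwoForm 𝓘(ℝ, ImH × ImH) TStar :=
  reDWedgeD 𝓘(ℝ, ImH × ImH) (fun x => star (coordP x)) coordQ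

/-- The 2-form `ω₁` on `V¹` is the reduced form: its pullback to `Σ¹` is the restriction of
`Re {dw̄ ∧ dz}`. -/
def IsReducedForm (β : TwoForm 𝓘(ℝ, ImH × ImH) V1) : Prop :=
  pullback 𝓘(ℝ, ℍ × ImH) 𝓘(ℝ, ImH × ImH) proj β = formSigma

end KS

end

open KS

/-!
The Kustaanheimo-Stiefel mapping as a symplectic reduction.

On `Σ¹` the quaternion `P = z̄ i w / (2 |z|²)` is imaginary and `w = -2 i z P`, so `w` can be
eliminated. Differentiating this relation and `Q = z̄ i z` turns `Re {dw̄ ∧ dz}` into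
`-2 Re {(P dz̄ + dP z̄) i ∧ dz}`. The term in `P` vanishes since `P` is imaginary while
`ū i v - v̄ i u` is real, and the term in `dP` equals `Re {dP̄ ∧ dQ}` since `dP` is imaginary. This
pointwise identity is `omegaH_ks`, and `pullback_ksMap_comp_subtypeVal` is its differential-form
version.

The mapping is constant on circle orbits, separates them, and is a submersion with smooth local
sections; hence it descends to a global chart `ksChart` of `V¹`, with image `{Q ≠ 0}`. A chart in
the quotient atlas is related to `ksChart` by a map which is smooth (compose with a local section
of `ksSigma`) and has surjective, hence by dimension bijective, derivative; the inverse function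
theorem then makes both transition maps smooth, so `V¹` is a manifold (`isManifold_V1`) and
`ksChart` a diffeomorphism onto `T^*(𝕀ℍ ∖ {0})` (`ksDiffeo`).

The form `Re {dP̄ ∧ dQ}` is constant on `𝕀ℍ × 𝕀ℍ`, where it is nondegenerate. The forms on
`T^*(𝕀ℍ ∖ {0})` and on `V¹` are its pullbacks along global charts, so both are symplectic by
`isSymplectic_pullback_constForm`. The reduced form is unique because the projection is a
surjective submersion.
-/

noncomputable section

namespace KS

/-! ### Constant forms and pullbacks -/

section Forms

variable {E H M E' H' M' E'' H'' M'' : Type*}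
  [NormedAddCommGroup E] [NormedSpace ℝ E] [TopologicalSpace H]
  [TopologicalSpace M] [ChartedSpace H M]
  [NormedAddCommGroup E'] [NormedSpace ℝ E'] [TopologicalSpace H']
  [TopologicalSpace M'] [ChartedSpace H' M']
  [NormedAddCommGroup E''] [NormedSpace ℝ E''] [TopologicalSpace H'']
  [TopologicalSpace M''] [ChartedSpace H'' M'']

/-- The pullback of an alternating form depends smoothly on the linear map. As a multilinear map it
is polynomial in the linear map; composing with a linear left inverse of the inclusion of alternating
into multilinear maps, continuous by finite dimensionality, gives the claim. -/
lemma contDiff_compContinuousLinearMap {ι : Type*} [Fintype ι] [FiniteDimensional ℝ E]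
    (σ : E' [⋀^ι]→L[ℝ] ℝ) :
    ContDiff ℝ ∞ (fun L : E →L[ℝ] E' => σ.compContinuousLinearMap L) := by
  let T : E [⋀^ι]→L[ℝ] ℝ →ₗ[ℝ] ContinuousMultilinearMap ℝ (fun _ : ι => E) ℝ :=
    ContinuousAlternatingMap.toContinuousMultilinearMapLinear
  have hT : LinearMap.ker T = ⊥ :=
    LinearMap.ker_eq_bot.2 ContinuousAlternatingMap.toContinuousMultilinearMap_injective
  let S : ContinuousMultilinearMap ℝ (fun _ : ι => E) ℝ →ₗ[ℝ]
      MultilinearMap ℝ (fun _ : ι => E) ℝ := ContinuousMultilinearMap.toMultilinearMapLinear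
  have : FiniteDimensional ℝ (ContinuousMultilinearMap ℝ (fun _ : ι => E) ℝ) :=
    FiniteDimensional.of_injective S ContinuousMultilinearMap.toMultilinearMap_injective
  obtain ⟨r, hr⟩ := T.exists_leftInverse_of_injective hT
  have h : (fun L : E →L[ℝ] E' => σ.compContinuousLinearMap L) = fun L =>
      LinearMap.toContinuousLinearMap r
        (ContinuousMultilinearMap.compContinuousLinearMapContinuousMultilinear ℝ
          (fun _ : ι => E) (fun _ => E') ℝ (fun _ => L) σ.toContinuousMultilinearMap) := by
    funext L
    exact (LinearMap.congr_fun hr (σ.compContinuousLinearMap L)).symm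
  rw [h]
  refine (ContinuousLinearMap.contDiff _).comp (ContDiff.clm_apply ?_ contDiff_const)
  exact (ContinuousMultilinearMap.contDiff _).comp (contDiff_pi.2 fun _ => contDiff_id)

lemma pullback_comp {I : ModelWithCorners ℝ E H} {I' : ModelWithCorners ℝ E' H'}
    {I'' : ModelWithCorners ℝ E'' H''} {f : M → M'} {g : M' → M''} (β : TwoForm I'' M'') {q : M}
    (hg : MDifferentiableAt I' I'' g (f q)) (hf : MDifferentiableAt I I' f q) :
    pullback I I' f (pullback I' I'' g β) q = pullback I I'' (g ∘ f) β q := by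
  simp only [pullback]
  rw [mfderiv_comp q hg hf]
  rfl

/-- The constant 2-form on a normed space with value `σ` at every point. -/
def constForm (σ : E [⋀^Fin 2]→L[ℝ] ℝ) : TwoForm 𝓘(ℝ, E) E := fun _ => σ

/-- A constant nondegenerate 2-form on the model space becomes symplectic when pulled back along a
global chart: in any other chart it is the pullback of a constant form by a change of coordinates,
hence smooth, and closed because `d` commutes with pullbacks. -/
lemma isSymplectic_pullback_constForm {M : Type*} [TopologicalSpace M] [ChartedSpace E M]
    [IsManifold 𝓘(ℝ, E) ∞ M] [FiniteDimensional ℝ E]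
    {k : OpenPartialHomeomorph M E} (hk : k ∈ atlas E M) (hks : k.source = Set.univ)
    {σ : E [⋀^Fin 2]→L[ℝ] ℝ} (hσ : ∀ u, (∀ v, σ ![u, v] = 0) → u = 0) :
    IsSymplectic (pullback 𝓘(ℝ, E) 𝓘(ℝ, E) k (constForm σ)) := by
  have : IsManifold 𝓘(ℝ, E) 1 M := IsManifold.of_le (n := ∞) (by simp)
  have hkm : k.MDifferentiable 𝓘(ℝ, E) 𝓘(ℝ, E) := mdifferentiable_of_mem_atlas hk
  have hsrc : ∀ q, q ∈ k.source := fun q => hks ▸ Set.mem_univ q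
  have hsm : ∀ e ∈ atlas E M, ContDiffOn ℝ ∞ (k ∘ e.symm) e.target := by
    intro e he
    rw [← contMDiffOn_iff_contDiffOn]
    exact (contMDiffOn_of_mem_maximalAtlas (IsManifold.subset_maximalAtlas hk)).comp
      (contMDiffOn_symm_of_mem_maximalAtlas (IsManifold.subset_maximalAtlas he))
      fun y _ => hsrc _
  have hrep : ∀ e ∈ atlas E M, ∀ y ∈ e.target,
      localRep e (pullback 𝓘(ℝ, E) 𝓘(ℝ, E) k (constForm σ)) y =
        σ.compContinuousLinearMap (fderiv ℝ (k ∘ e.symm) y) := by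
    intro e he y hy
    rw [← mfderiv_eq_fderiv]
    exact pullback_comp (constForm σ) (hkm.mdifferentiableAt (hsrc _))
      ((mdifferentiable_of_mem_atlas he).mdifferentiableAt_symm hy)
  refine ⟨fun q u hu => ?_, fun e he => ?_, fun e he y hy => ?_⟩
  · have hb := hkm.mfderiv_bijective (hsrc q)
    refine hb.1 ((hσ (mfderiv 𝓘(ℝ, E) 𝓘(ℝ, E) k q u) fun v => ?_).trans (map_zero _).symm)
    obtain ⟨w, rfl⟩ := hb.2 v
    rw [← hu w]
    change σ _ = σ _
    congr 1
    funext i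
    fin_cases i <;> rfl
  · refine ContDiffOn.congr ?_ (hrep e he)
    exact (contDiff_compContinuousLinearMap σ).comp_contDiffOn
      ((hsm e he).fderiv_of_isOpen e.open_target (by simp))
  · have h1 : localRep e (pullback 𝓘(ℝ, E) 𝓘(ℝ, E) k (constForm σ)) =ᶠ[𝓝 y] fun y =>
        σ.compContinuousLinearMap (fderiv ℝ (k ∘ e.symm) y) := by
      filter_upwards [e.open_target.mem_nhds hy] with x hx using hrep e he x hx
    have hy' : ContDiffAt ℝ ∞ (k ∘ e.symm) y :=
      (hsm e he).contDiffAt (e.open_target.mem_nhds hy)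
    have hσ' : DifferentiableAt ℝ (fun _ : E => σ) ((k ∘ e.symm) y) := differentiableAt_const _
    rw [h1.extDeriv_eq, extDeriv_pullback hσ' hy' (by simpa using ENat.LEInfty.out)]
    have h0 : extDeriv (fun _ : E => σ) ((k ∘ e.symm) y) = 0 := by
      rw [extDeriv, fderiv_fun_const]
      ext v
      simp [ContinuousAlternatingMap.alternatizeUncurryFin_apply]
    rw [h0]
    rfl

end Forms

/-! ### The Kustaanheimo-Stiefel identity -/

/-- Quaternionic conjugation as a real linear map. -/
def starH : ℍ →L[ℝ] ℍ :=
  LinearMap.toContinuousLinearMap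
    { toFun := fun z : ℍ => star z
      map_add' := star_add
      map_smul' := Quaternion.star_smul }

/-- The constant value `(u, v) ↦ Re (ū₂ v₁ - v̄₂ u₁)` of `Re {dw̄ ∧ dz}`. -/
def omegaH : (ℍ × ℍ) [⋀^Fin 2]→L[ℝ] ℝ :=
  reWedge (starH ∘L ContinuousLinearMap.snd ℝ ℍ ℍ)
    (ContinuousLinearMap.fst ℝ ℍ ℍ)

lemma omegaH_apply (v : Fin 2 → ℍ × ℍ) :
    omegaH v = (star (v 0).2 * (v 1).1 - star (v 1).2 * (v 0).1).re := rfl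

lemma formH_eq (q : ℍ × ℍ) : formH q = omegaH := by
  have h1 : mfderiv 𝓘(ℝ, ℍ × ℍ) 𝓘(ℝ, ℍ) (fun x : ℍ × ℍ => star x.2) q =
      starH ∘L ContinuousLinearMap.snd ℝ ℍ ℍ := by
    rw [mfderiv_eq_fderiv]
    exact (starH ∘L ContinuousLinearMap.snd ℝ ℍ ℍ).fderiv
  have h2 : mfderiv 𝓘(ℝ, ℍ × ℍ) 𝓘(ℝ, ℍ) (fun x : ℍ × ℍ => x.1) q =
      ContinuousLinearMap.fst ℝ ℍ ℍ := by
    rw [mfderiv_eq_fderiv]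
    exact (ContinuousLinearMap.fst ℝ ℍ ℍ).fderiv
  rw [formH, reDWedgeD, h1, h2]
  rfl

/-- With `w = -2 i z P`, `Q = z̄ i z` and `P` imaginary one has
`Re {dw̄ ∧ dz} = Re {dP̄ ∧ dQ}`; here `a`, `b` are values of `dz` and `A`, `B` values of `dP`. -/
lemma omegaH_ks (z P a b A B : ℍ) (hP : P.re = 0) (hA : A.re = 0) (hB : B.re = 0) :
    omegaH ![(star a * qi * z + star z * qi * a, A), (star b * qi * z + star z * qi * b, B)] =
      omegaH ![(a, -(2 : ℝ) • (qi * (a * P + z * A))),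
        (b, -(2 : ℝ) • (qi * (b * P + z * B)))] := by
  simp [omegaH_apply, hP, hA, hB]
  ring

/-! ### `Σ¹` as an embedded hypersurface -/

/-- The tangent spaces of `Σ¹` are those of the model space through `sigmaChart`, so the derivative
of this chart is the identity. -/
lemma hasMFDerivAt_sigmaChart (p : Sigma1) :
    HasMFDerivAt 𝓘(ℝ, ℍ × ImH) 𝓘(ℝ, ℍ × ImH) sigmaChart p
      (ContinuousLinearMap.id ℝ (ℍ × ImH)) := by
  refine ⟨sigmaChart.continuousAt (Set.mem_univ p), ?_⟩
  have h : writtenInExtChartAt 𝓘(ℝ, ℍ × ImH) 𝓘(ℝ, ℍ × ImH) p sigmaChart =ᶠ[𝓝 (sigmaChart p)]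
      id := by
    filter_upwards [sigmaChart.open_target.mem_nhds (sigmaChart.map_source (Set.mem_univ p))]
      with u hu using sigmaChart.right_inv hu
  exact ((hasFDerivAt_id _).congr_of_eventuallyEq h).hasFDerivWithinAt

/-- The map `(z, y) ↦ (z, w)` with `z̄ i w = y`. -/
def flatInv (u : ℍ × ℍ) : ℍ × ℍ := (u.1, -((‖u.1‖ ^ 2)⁻¹ • (qi * u.1 * u.2)))

lemma contDiffAt_flatInv {u : ℍ × ℍ} (hu : u.1 ≠ 0) : ContDiffAt ℝ ∞ flatInv u := by
  refine contDiffAt_fst.prodMk (ContDiffAt.neg (ContDiffAt.fun_smul ?_ ?_))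
  · exact ((contDiff_norm_sq ℝ).comp contDiff_fst).contDiffAt.inv
      (pow_ne_zero 2 (norm_ne_zero_iff.2 hu))
  · exact (contDiffAt_const.mul contDiffAt_fst).mul contDiffAt_snd

lemma contDiff_flat : ContDiff ℝ ∞ (fun x : ℍ × ℍ => (x.1, star x.1 * qi * x.2)) :=
  contDiff_fst.prodMk (((contDiff_star.comp contDiff_fst).mul contDiff_const).mul contDiff_snd)

/-- The chart `(z, w) ↦ (z, z̄ i w)` of `{z ≠ 0} ⊆ ℍ × ℍ`, which flattens `Σ¹` to
`ℍ × 𝕀ℍ`. -/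
def flatChart : OpenPartialHomeomorph (ℍ × ℍ) (ℍ × ℍ) where
  toFun x := (x.1, star x.1 * qi * x.2)
  invFun := flatInv
  source := {x | x.1 ≠ 0}
  target := {u | u.1 ≠ 0}
  map_source' := fun _ hx => hx
  map_target' := fun _ hx => hx
  left_inv' := fun x hx => Prod.ext rfl (inv_star_mul_qi_mul hx x.2)
  right_inv' := fun u hu => Prod.ext rfl (star_mul_qi_mul_inv hu u.2)
  open_source := isOpen_ne.preimage continuous_fst
  open_target := isOpen_ne.preimage continuous_fst
  continuousOn_toFun := contDiff_flat.continuous.continuousOn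
  continuousOn_invFun := fun _ hu => (contDiffAt_flatInv hu).continuousAt.continuousWithinAt

lemma flatChart_mem_maximalAtlas :
    flatChart ∈ IsManifold.maximalAtlas 𝓘(ℝ, ℍ × ℍ) ∞ (ℍ × ℍ) := by
  have h1 : flatChart ∈ contDiffGroupoid ∞ 𝓘(ℝ, ℍ × ℍ) := by
    rw [contDiffGroupoid, mem_groupoid_of_pregroupoid]
    refine ⟨?_, ?_⟩
    · simp only [contDiffPregroupoid]
      exact contDiff_flat.contDiffOn
    · simp only [contDiffPregroupoid]
      rintro u ⟨hu, -⟩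
      exact (contDiffAt_flatInv hu).contDiffWithinAt
  exact StructureGroupoid.mem_maximalAtlas_of_mem_groupoid _ h1

/-- The splitting `(ℍ × 𝕀ℍ) × ℝ ≃ ℍ × ℍ`, `((z, y), t) ↦ (z, y + t)`. -/
def splitEquiv : ((ℍ × ImH) × ℝ) ≃L[ℝ] (ℍ × ℍ) :=
  LinearEquiv.toContinuousLinearEquiv
    { toFun := fun v => (v.1.1, (v.1.2 : ℍ) + (v.2 : ℍ))
      map_add' := fun u v => Prod.ext rfl (by simp; abel)
      map_smul' := fun c v => Prod.ext rfl (by simp [Quaternion.coe_mul_eq_smul])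
      invFun := fun u => ((u.1, ⟨u.2.im, Quaternion.re_im u.2⟩), u.2.re)
      left_inv := fun v => by
        have h : (v.1.2 : ℍ).re = 0 := v.1.2.2
        refine Prod.ext (Prod.ext rfl (Subtype.ext ?_)) ?_
        · ext <;> simp [h]
        · simp [h]
      right_inv := fun u => Prod.ext rfl (by simp [add_comm]) }

lemma isSmoothEmbedding_subtypeVal :
    Manifold.IsSmoothEmbedding 𝓘(ℝ, ℍ × ImH) 𝓘(ℝ, ℍ × ℍ) ∞ (Subtype.val : Sigma1 → ℍ × ℍ) := by
  refine ⟨⟨ℝ, inferInstance, inferInstance, fun p => ?_⟩, Topology.IsEmbedding.subtypeVal⟩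
  refine Manifold.IsImmersionAtOfComplement.mk_of_charts splitEquiv sigmaChart flatChart
    (Set.mem_univ p) p.2.2 (IsManifold.subset_maximalAtlas (Set.mem_singleton sigmaChart))
    flatChart_mem_maximalAtlas (fun x _ => x.2.2) ?_
  intro u hu
  have hu' : u ∈ sigmaChart.target := by simpa using hu
  have h := sigmaChart.right_inv hu'
  have h1 : flatChart (sigmaChart.symm u).1 =
    ((sigmaChart (sigmaChart.symm u)).1, ((sigmaChart (sigmaChart.symm u)).2 : ℍ)) := rfl
  have h2 : splitEquiv (u, 0) = (u.1, (u.2 : ℍ)) := by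
    change (u.1, (u.2 : ℍ) + ((0 : ℝ) : ℍ)) = _
    simp
  change flatChart (sigmaChart.symm u).1 = splitEquiv (u, 0)
  rw [h1, h2, h]

/-! ### The quotient manifold `V¹` -/

/-- The global chart of `V¹` given by the Kustaanheimo-Stiefel mapping. -/
def ksChart : OpenPartialHomeomorph V1 (ImH × ImH) :=
  isOpenEmbedding_ksQuot.toOpenPartialHomeomorph ksQuot

lemma ksChart_mem_atlas : ksChart ∈ atlas (ImH × ImH) V1 :=
  fun p _ => ⟨contMDiff_ksSigma p, surjective_mfderiv_ksSigma p⟩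

lemma proj_surjective : Function.Surjective proj := Quotient.mk_surjective

lemma ksChart_symm_ksSigma (p : Sigma1) : ksChart.symm (ksSigma p) = proj p :=
  ksChart.left_inv (Set.mem_univ (proj p))

lemma ksChart_proj (p : Sigma1) : ksChart (proj p) = ksSigma p := rfl

/-- In the global chart every chart of `V¹` is smooth, since `ksSigma` has smooth local sections. -/
lemma contDiffAt_comp_ksChart_symm {e : OpenPartialHomeomorph V1 (ImH × ImH)}
    (he : e ∈ quotientAtlas) {p : Sigma1} (hp : proj p ∈ e.source) :
    ContDiffAt ℝ ∞ (e ∘ ksChart.symm) (ksSigma p) := by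
  have h1 : ContMDiffAt 𝓘(ℝ, ImH × ImH) 𝓘(ℝ, ImH × ImH) ∞
      ((fun x => e (proj x)) ∘ secSigma p) (ksSigma p) := by
    refine ContMDiffAt.comp _ ?_ (contMDiffAt_secSigma p)
    rw [secSigma_self]
    exact (he p hp).1
  refine h1.contDiffAt.congr_of_eventuallyEq ?_
  filter_upwards [ksSigma_secSigma p] with x hx
  simp only [Function.comp_apply]
  rw [← ksChart_symm_ksSigma, hx]

/-- The derivative of a transition map from the global chart is bijective: it is surjective because
the chart is submersive over `Σ¹`, and both sides have the same dimension. -/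
lemma exists_hasFDerivAt_comp_ksChart_symm {e : OpenPartialHomeomorph V1 (ImH × ImH)}
    (he : e ∈ quotientAtlas) {p : Sigma1} (hp : proj p ∈ e.source) :
    ∃ L : (ImH × ImH) ≃L[ℝ] (ImH × ImH),
      HasFDerivAt (e ∘ ksChart.symm) (L : (ImH × ImH) →L[ℝ] (ImH × ImH)) (ksSigma p) := by
  have hd : DifferentiableAt ℝ (e ∘ ksChart.symm) (ksSigma p) :=
    (contDiffAt_comp_ksChart_symm he hp).differentiableAt (by simp)
  have hs : Function.Surjective (fderiv ℝ (e ∘ ksChart.symm) (ksSigma p)) := by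
    intro v
    obtain ⟨u, hu⟩ := (he p hp).2 v
    have h1 : (fun x => e (proj x)) = (e ∘ ksChart.symm) ∘ ksSigma := by
      funext x
      simp only [Function.comp_apply]
      rw [ksChart_symm_ksSigma]
    have h2 := mfderiv_comp p hd.mdifferentiableAt
      ((contMDiff_ksSigma p).mdifferentiableAt (by simp))
    rw [← h1, mfderiv_eq_fderiv] at h2
    refine ⟨mfderiv 𝓘(ℝ, ℍ × ImH) 𝓘(ℝ, ImH × ImH) ksSigma p u, ?_⟩
    rw [← hu, h2]
    rfl
  have hi : Function.Injective (fderiv ℝ (e ∘ ksChart.symm) (ksSigma p)) :=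
    (LinearMap.injective_iff_surjective
      (f := (fderiv ℝ (e ∘ ksChart.symm) (ksSigma p)).toLinearMap)).2 hs
  let L := ContinuousLinearEquiv.ofBijective (fderiv ℝ (e ∘ ksChart.symm) (ksSigma p))
    (LinearMap.ker_eq_bot.2 hi) (LinearMap.range_eq_top.2 hs)
  exact ⟨L, hd.hasFDerivAt⟩

/-- By the inverse function theorem, the transition maps to the global chart are smooth. -/
lemma contDiffAt_ksChart_comp_symm {e : OpenPartialHomeomorph V1 (ImH × ImH)}
    (he : e ∈ quotientAtlas) {y : ImH × ImH} (hy : y ∈ e.target) :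
    ContDiffAt ℝ ∞ (ksChart ∘ e.symm) y := by
  obtain ⟨p, hp⟩ := proj_surjective (e.symm y)
  have hpe : proj p ∈ e.source := hp ▸ e.map_target hy
  have hp' : ksSigma p = ksChart (e.symm y) := by rw [← ksChart_proj, hp]
  obtain ⟨L, hL⟩ := exists_hasFDerivAt_comp_ksChart_symm he hpe
  have hc := contDiffAt_comp_ksChart_symm he hpe
  rw [hp'] at hL hc
  exact (ksChart.symm.trans e).contDiffAt_symm
    (by rw [OpenPartialHomeomorph.trans_target]; exact ⟨hy, Set.mem_univ _⟩) hL hc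

instance isManifold_V1 : IsManifold 𝓘(ℝ, ImH × ImH) ∞ V1 := by
  refine isManifold_of_contDiffOn _ _ _ fun e e' he he' => ?_
  rintro y ⟨hy, -⟩
  have hy' : y ∈ e.target ∧ e.symm y ∈ e'.source := by simpa using hy
  obtain ⟨p, hp⟩ := proj_surjective (e.symm y)
  have h1 := contDiffAt_ksChart_comp_symm he hy'.1
  have h2 := contDiffAt_comp_ksChart_symm he' (hp ▸ hy'.2 : proj p ∈ e'.source)
  rw [← ksChart_proj, hp] at h2
  refine (ContDiffAt.congr_of_eventuallyEq (h2.comp y h1) ?_).contDiffWithinAt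
  refine Filter.Eventually.of_forall fun x => ?_
  exact congrArg e' (ksChart.left_inv (Set.mem_univ (e.symm x))).symm

lemma contMDiff_ksQuot : ContMDiff 𝓘(ℝ, ImH × ImH) 𝓘(ℝ, ImH × ImH) ∞ ksQuot :=
  contMDiffOn_univ.1
    (contMDiffOn_of_mem_maximalAtlas (IsManifold.subset_maximalAtlas ksChart_mem_atlas))

lemma contMDiffOn_ksChart_symm :
    ContMDiffOn 𝓘(ℝ, ImH × ImH) 𝓘(ℝ, ImH × ImH) ∞ ksChart.symm ksChart.target :=
  contMDiffOn_symm_of_mem_maximalAtlas (IsManifold.subset_maximalAtlas ksChart_mem_atlas)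

lemma contMDiff_proj : ContMDiff 𝓘(ℝ, ℍ × ImH) 𝓘(ℝ, ImH × ImH) ∞ proj := by
  have h : proj = ksChart.symm ∘ ksSigma := funext fun p => (ksChart_symm_ksSigma p).symm
  rw [h]
  exact contMDiffOn_ksChart_symm.comp_contMDiff contMDiff_ksSigma
    fun p => ksChart.map_source (Set.mem_univ (proj p))

/-- The derivative of `ksSigma = ksChart ∘ proj` is surjective and that of `ksChart` injective. -/
lemma surjective_mfderiv_proj (p : Sigma1) :
    Function.Surjective (mfderiv 𝓘(ℝ, ℍ × ImH) 𝓘(ℝ, ImH × ImH) proj p) := by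
  have : IsManifold 𝓘(ℝ, ImH × ImH) 1 V1 := IsManifold.of_le (n := ∞) (by simp)
  have hb := (mdifferentiable_of_mem_atlas (I := 𝓘(ℝ, ImH × ImH))
    ksChart_mem_atlas).mfderiv_bijective (Set.mem_univ (proj p))
  have h : mfderiv 𝓘(ℝ, ℍ × ImH) 𝓘(ℝ, ImH × ImH) ksSigma p = _ :=
    mfderiv_comp (g := ksQuot) (f := proj) p ((contMDiff_ksQuot _).mdifferentiableAt (by simp))
      ((contMDiff_proj p).mdifferentiableAt (by simp))
  intro v
  obtain ⟨u, hu⟩ := surjective_mfderiv_ksSigma p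
    (mfderiv 𝓘(ℝ, ImH × ImH) 𝓘(ℝ, ImH × ImH) ksQuot (proj p) v)
  rw [h] at hu
  exact ⟨u, hb.1 hu⟩

/-! ### The pullback of the symplectic form to `Σ¹` -/

lemma coe_ksSigma (p : Sigma1) : (((ksSigma p).1 : ℍ), ((ksSigma p).2 : ℍ)) = ksMap p := rfl

/-- On `Σ¹` one has `w = -2 i z P`. -/
lemma subtypeVal_eq_ksCoord (p : Sigma1) :
    (p : ℍ × ℍ) = ((sigmaChart p).1,
      -(2 : ℝ) • (qi * ((sigmaChart p).1 * ((ksCoord (sigmaChart p)).2 : ℍ)))) := by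
  refine Prod.ext rfl ?_
  have hz := p.2.2
  have h := inv_star_mul_qi_mul hz p.1.2
  change p.1.2 = -(2 : ℝ) • (qi * (p.1.1 * ((2 * ‖p.1.1‖ ^ 2)⁻¹ • (star p.1.1 * qi * p.1.2))))
  conv_lhs => rw [← h]
  rw [mul_smul_comm, mul_smul_comm, smul_smul, ← neg_smul, mul_assoc qi]
  congr 1
  have := norm_ne_zero_iff.2 hz
  field_simp

lemma hasFDerivAt_coe_snd_ksCoord {u : ℍ × ImH} (hu : u.1 ≠ 0) :
    HasFDerivAt (fun x => ((ksCoord x).2 : ℍ))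
      (ImH.subtypeL ∘L ContinuousLinearMap.snd ℝ ImH ImH ∘L fderiv ℝ ksCoord u) u :=
  (ImH.subtypeL.hasFDerivAt).comp u ((ContinuousLinearMap.snd ℝ ImH ImH).hasFDerivAt.comp u
    ((contDiffAt_ksCoord hu).differentiableAt (by simp)).hasFDerivAt)

lemma mfderiv_subtypeVal (p : Sigma1) (v : TangentSpace 𝓘(ℝ, ℍ × ImH) p) :
    mfderiv 𝓘(ℝ, ℍ × ImH) 𝓘(ℝ, ℍ × ℍ) (Subtype.val : Sigma1 → ℍ × ℍ) p v =
      (v.1, -(2 : ℝ) • (qi * (v.1 * ((ksCoord (sigmaChart p)).2 : ℍ) +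
        (sigmaChart p).1 * ((fderiv ℝ ksCoord (sigmaChart p) v).2 : ℍ)))) := by
  have h1 : HasFDerivAt (fun u : ℍ × ImH => u.1) (ContinuousLinearMap.fst ℝ ℍ ImH) (sigmaChart p) :=
    hasFDerivAt_fst
  have h2 := h1.prodMk
    (((h1.mul' (hasFDerivAt_coe_snd_ksCoord (sigmaChart_ne p))).const_mul qi).const_smul (-(2 : ℝ)))
  have h3 := h2.hasMFDerivAt.comp p (hasMFDerivAt_sigmaChart p)
  have h4 := h3.congr_of_eventuallyEq (f₁ := Subtype.val)
    (Filter.Eventually.of_forall subtypeVal_eq_ksCoord)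
  rw [h4.mfderiv]
  refine Prod.ext rfl ?_
  change -(2 : ℝ) • (qi * ((sigmaChart p).1 * ((fderiv ℝ ksCoord (sigmaChart p) v).2 : ℍ) +
    v.1 * ((ksCoord (sigmaChart p)).2 : ℍ))) = _
  rw [add_comm]

lemma mfderiv_ksMap_comp_subtypeVal (p : Sigma1) (v : TangentSpace 𝓘(ℝ, ℍ × ImH) p) :
    mfderiv 𝓘(ℝ, ℍ × ImH) 𝓘(ℝ, ℍ × ℍ) (ksMap ∘ (Subtype.val : Sigma1 → ℍ × ℍ)) p v =
      (star v.1 * qi * (sigmaChart p).1 + star (sigmaChart p).1 * qi * v.1,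
        ((fderiv ℝ ksCoord (sigmaChart p) v).2 : ℍ)) := by
  have h1 : HasFDerivAt (fun u : ℍ × ImH => u.1) (ContinuousLinearMap.fst ℝ ℍ ImH) (sigmaChart p) :=
    hasFDerivAt_fst
  have h2 := ((((starH.hasFDerivAt).comp _ h1).mul_const' qi).mul' h1).prodMk
    (hasFDerivAt_coe_snd_ksCoord (sigmaChart_ne p))
  have h3 := h2.hasMFDerivAt.comp p (hasMFDerivAt_sigmaChart p)
  have h4 := h3.congr_of_eventuallyEq (f₁ := ksMap ∘ Subtype.val)
    (Filter.Eventually.of_forall fun _ => rfl)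
  rw [h4.mfderiv]
  refine Prod.ext ?_ rfl
  change star (sigmaChart p).1 * qi * v.1 + star v.1 * qi * (sigmaChart p).1 = _
  rw [add_comm]

lemma compContinuousLinearMap_apply_pair {V W : Type*} [AddCommGroup V] [Module ℝ V]
    [TopologicalSpace V] [AddCommGroup W] [Module ℝ W] [TopologicalSpace W]
    (σ : W [⋀^Fin 2]→L[ℝ] ℝ) (L : V →L[ℝ] W) (v : Fin 2 → V) :
    σ.compContinuousLinearMap L v = σ ![L (v 0), L (v 1)] := by
  rw [ContinuousAlternatingMap.compContinuousLinearMap_apply]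
  congr 1
  funext i
  fin_cases i <;> rfl

lemma pullback_ksMap_comp_subtypeVal :
    pullback 𝓘(ℝ, ℍ × ImH) 𝓘(ℝ, ℍ × ℍ) (ksMap ∘ (Subtype.val : Sigma1 → ℍ × ℍ)) formH =
      formSigma := by
  funext p
  ext v
  rw [formSigma, pullback, pullback, formH_eq, formH_eq]
  have h := omegaH_ks (sigmaChart p).1 ((ksCoord (sigmaChart p)).2 : ℍ) (v 0).1 (v 1).1 _ _
    (ksCoord (sigmaChart p)).2.2
    (fderiv ℝ ksCoord (sigmaChart p) (v 0)).2.2 (fderiv ℝ ksCoord (sigmaChart p) (v 1)).2.2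
  have h1 := congrArg₂ (fun a b : ℍ × ℍ => omegaH ![a, b])
    (mfderiv_ksMap_comp_subtypeVal p (v 0)) (mfderiv_ksMap_comp_subtypeVal p (v 1))
  have h2 := congrArg₂ (fun a b : ℍ × ℍ => omegaH ![a, b])
    (mfderiv_subtypeVal p (v 0)) (mfderiv_subtypeVal p (v 1))
  exact (compContinuousLinearMap_apply_pair omegaH _ v).trans
    (((h1.trans h).trans h2.symm).trans (compContinuousLinearMap_apply_pair omegaH _ v).symm)

lemma differentiableAt_ksMap {x : ℍ × ℍ} (hx : x.1 ≠ 0) : DifferentiableAt ℝ ksMap x := by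
  have h1 : ContDiff ℝ ∞ (fun x : ℍ × ℍ => star x.1 * qi) :=
    (contDiff_star.comp contDiff_fst).mul contDiff_const
  have h2 : ContDiffAt ℝ ∞ (fun x : ℍ × ℍ => (2 * ‖x.1‖ ^ 2)⁻¹) x := by
    refine ContDiffAt.inv
      (contDiffAt_const.mul ((contDiff_norm_sq ℝ).comp contDiff_fst).contDiffAt) ?_
    have := norm_ne_zero_iff.2 hx
    positivity
  have h3 : ContDiffAt ℝ ∞ ksMap x :=
    (h1.mul contDiff_fst).contDiffAt.prodMk (h2.fun_smul (h1.mul contDiff_snd).contDiffAt)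
  exact h3.differentiableAt (by simp)

lemma pullback_pullback_ksMap :
    pullback 𝓘(ℝ, ℍ × ImH) 𝓘(ℝ, ℍ × ℍ) (Subtype.val : Sigma1 → ℍ × ℍ)
        (pullback 𝓘(ℝ, ℍ × ℍ) 𝓘(ℝ, ℍ × ℍ) ksMap formH) = formSigma := by
  rw [← pullback_ksMap_comp_subtypeVal]
  funext p
  exact pullback_comp formH (differentiableAt_ksMap p.2.2).mdifferentiableAt
    ((isSmoothEmbedding_subtypeVal.contMDiff p).mdifferentiableAt (by simp))

/-! ### The symplectic form of `T^*(𝕀ℍ ∖ {0})` -/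

/-- The inclusion `𝕀ℍ × 𝕀ℍ → ℍ × ℍ`. -/
def inclH : (ImH × ImH) →L[ℝ] (ℍ × ℍ) := ImH.subtypeL.prodMap ImH.subtypeL

/-- The constant value of `Re {dP̄ ∧ dQ}` on `𝕀ℍ × 𝕀ℍ`. -/
def omegaIm : (ImH × ImH) [⋀^Fin 2]→L[ℝ] ℝ := omegaH.compContinuousLinearMap inclH

lemma omegaIm_apply (u v : ImH × ImH) :
    omegaIm ![u, v] = (star (u.2 : ℍ) * (v.1 : ℍ) - star (v.2 : ℍ) * (u.1 : ℍ)).re := rfl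

lemma omegaIm_nondegenerate (u : ImH × ImH) (h : ∀ v, omegaIm ![u, v] = 0) : u = 0 := by
  -- Testing against `(u₂, -u₁)` gives `|u₂|² + |u₁|² = 0`.
  have h1 := h (u.2, -u.1)
  have e : ∀ q : ℍ, (star q * q).re = ‖q‖ ^ 2 := fun q => by
    rw [star_mul_self', Quaternion.re_coe]
  rw [omegaIm_apply] at h1
  simp only [NegMemClass.coe_neg, star_neg, neg_mul, sub_neg_eq_add, Quaternion.re_add, e] at h1
  have h2 := sq_nonneg ‖(u.1 : ℍ)‖
  have h3 := sq_nonneg ‖(u.2 : ℍ)‖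
  refine Prod.ext (Subtype.ext ?_) (Subtype.ext ?_)
  · exact norm_eq_zero.1 (pow_eq_zero_iff two_ne_zero |>.1 (by linarith))
  · exact norm_eq_zero.1 (pow_eq_zero_iff two_ne_zero |>.1 (by linarith))

lemma contMDiff_tStar_val : ContMDiff 𝓘(ℝ, ImH × ImH) 𝓘(ℝ, ImH × ImH) ∞
    (Subtype.val : TStar → ImH × ImH) := contMDiff_subtype_val

lemma formTStar_eq : formTStar =
    pullback 𝓘(ℝ, ImH × ImH) 𝓘(ℝ, ImH × ImH) (Subtype.val : TStar → ImH × ImH)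
      (constForm omegaIm) := by
  funext q
  have hv : MDifferentiableAt 𝓘(ℝ, ImH × ImH) 𝓘(ℝ, ImH × ImH)
      (Subtype.val : TStar → ImH × ImH) q := (contMDiff_tStar_val q).mdifferentiableAt (by simp)
  have key : ∀ A : (ImH × ImH) →L[ℝ] ℍ,
      mfderiv 𝓘(ℝ, ImH × ImH) 𝓘(ℝ, ℍ) (fun x : TStar => A x.1) q =
        A ∘L mfderiv 𝓘(ℝ, ImH × ImH) 𝓘(ℝ, ImH × ImH) (Subtype.val : TStar → ImH × ImH) q :=
    fun A => (A.hasFDerivAt.hasMFDerivAt.comp q hv.hasMFDerivAt).mfderiv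
  have h1 := key (starH ∘L ContinuousLinearMap.snd ℝ ℍ ℍ ∘L inclH)
  have h2 := key (ContinuousLinearMap.fst ℝ ℍ ℍ ∘L inclH)
  ext v
  change reWedge (mfderiv 𝓘(ℝ, ImH × ImH) 𝓘(ℝ, ℍ) (fun x : TStar =>
      (starH ∘L ContinuousLinearMap.snd ℝ ℍ ℍ ∘L inclH) x.1) q)
    (mfderiv 𝓘(ℝ, ImH × ImH) 𝓘(ℝ, ℍ) (fun x : TStar =>
      (ContinuousLinearMap.fst ℝ ℍ ℍ ∘L inclH) x.1) q) v = _
  rw [h1, h2]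
  rfl

lemma isSymplectic_formTStar : IsSymplectic formTStar := by
  have hi : qi ∈ ImH := qi_re
  have hq : ((⟨qi, hi⟩, 0) : ImH × ImH) ∈ TStar := by
    intro h
    have h2 : qi = 0 := congrArg Subtype.val h
    have h1 := norm_qi
    rw [h2, norm_zero] at h1
    exact zero_ne_one h1
  rw [formTStar_eq]
  exact isSymplectic_pullback_constForm (k := chartAt (ImH × ImH) (⟨_, hq⟩ : TStar))
    (chart_mem_atlas _ _)
    (by rw [TopologicalSpace.Opens.chartAt_eq, OpenPartialHomeomorph.subtypeRestr_source]; rfl)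
    omegaIm_nondegenerate

/-! ### The diffeomorphism between `V¹` and `T^*(𝕀ℍ ∖ {0})` -/

/-- The local sections of `z ↦ z̄ i z` at `1` and at `j` have complementary exceptional
directions, so every nonzero imaginary quaternion is of the form `z̄ i z`. -/
lemma exists_hopf_eq {Q : ℍ} (hQ : Q ∈ ImH) (hQ0 : Q ≠ 0) : ∃ z : ℍ, star z * qi * z = Q := by
  obtain ⟨j, j0, j1, j2, j3⟩ : ∃ j : ℍ, j.re = 0 ∧ j.imI = 0 ∧ j.imJ = 1 ∧ j.imK = 0 :=
    ⟨⟨0, 0, 1, 0⟩, rfl, rfl, rfl, rfl⟩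
  by_cases h1 : secAux 1 Q = 0
  · by_cases h2 : secAux j Q = 0
    -- The real part of the first equation gives `Q.imI = -‖Q‖`, the `j`-part of the second `‖Q‖`.
    · exfalso
      have e1 := congrArg (fun q : ℍ => q.re) h1
      have e2 := congrArg (fun q : ℍ => q.imJ) h2
      simp [secAux, j0, j1, j2, j3] at e1 e2
      linarith
    · exact ⟨_, hopf_sec hQ hQ0 h2⟩
  · exact ⟨_, hopf_sec hQ hQ0 h1⟩

lemma ksSigma_mem_TStar (p : Sigma1) : ksSigma p ∈ TStar := by
  intro h
  have h1 := norm_hopf p.1.1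
  have h2 : star p.1.1 * qi * p.1.1 = 0 := congrArg Subtype.val h
  rw [h2, norm_zero] at h1
  exact pow_ne_zero 2 (norm_ne_zero_iff.2 p.2.2) h1.symm

lemma ksQuot_mem_TStar (q : V1) : ksQuot q ∈ TStar := by
  obtain ⟨p, rfl⟩ := proj_surjective q
  exact ksSigma_mem_TStar p

lemma mem_ksChart_target (x : TStar) : (x : ImH × ImH) ∈ ksChart.target := by
  obtain ⟨z, hz⟩ := exists_hopf_eq x.1.1.2 (fun h => x.2 (Subtype.ext h))
  have hz0 : z ≠ 0 := by
    rintro rfl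
    exact x.2 (Subtype.ext (by rw [← hz]; simp))
  have hn := norm_ne_zero_iff.2 hz0
  have h : ksCoord (z, (2 * ‖z‖ ^ 2) • x.1.2) = x.1 := by
    refine Prod.ext (Subtype.ext hz) ?_
    simp only [ksCoord, smul_smul]
    rw [inv_mul_cancel₀ (by positivity), one_smul]
  have h2 : ksSigma (sigmaChart.symm (z, (2 * ‖z‖ ^ 2) • x.1.2)) = x.1 := by
    rw [ksSigma, sigmaChart.right_inv hz0, h]
  rw [← h2]
  exact ksChart.map_source (Set.mem_univ (proj _))

/-- The diffeomorphism from `V¹` to `T^*(𝕀ℍ ∖ {0})` induced by the Kustaanheimo-Stiefel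
mapping. -/
def ksDiffeo : V1 ≃ₘ^∞⟮𝓘(ℝ, ImH × ImH), 𝓘(ℝ, ImH × ImH)⟯ TStar where
  toFun q := ⟨ksQuot q, ksQuot_mem_TStar q⟩
  invFun x := ksChart.symm x
  left_inv q := ksChart.left_inv (Set.mem_univ q)
  right_inv x := Subtype.ext (ksChart.right_inv (mem_ksChart_target x))
  contMDiff_toFun := by
    refine (ContMDiff.iff_comp_isImmersion (Manifold.IsImmersion.of_opens TStar)).2
      ⟨contMDiff_ksQuot.continuous.subtype_mk _, contMDiff_ksQuot⟩
  contMDiff_invFun := contMDiffOn_ksChart_symm.comp_contMDiff contMDiff_tStar_val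
    mem_ksChart_target

/-! ### The reduced form -/

lemma pullback_ksDiffeo_formTStar :
    pullback 𝓘(ℝ, ImH × ImH) 𝓘(ℝ, ImH × ImH) ksDiffeo formTStar =
      pullback 𝓘(ℝ, ImH × ImH) 𝓘(ℝ, ImH × ImH) ksChart (constForm omegaIm) := by
  rw [formTStar_eq]
  funext q
  exact pullback_comp (constForm omegaIm) ((contMDiff_tStar_val _).mdifferentiableAt (by simp))
    ((ksDiffeo.contMDiff q).mdifferentiableAt (by simp))

/-- The pullback to `Σ¹` of the constant form read in the global chart is the pullback of
`Re {dP̄ ∧ dQ}` along the Kustaanheimo-Stiefel mapping, as `ksChart ∘ proj` is its restriction to `Σ¹`. -/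
lemma isReducedForm_pullback_ksChart :
    IsReducedForm (pullback 𝓘(ℝ, ImH × ImH) 𝓘(ℝ, ImH × ImH) ksChart (constForm omegaIm)) := by
  rw [IsReducedForm, ← pullback_ksMap_comp_subtypeVal]
  funext p
  have hk : MDifferentiableAt 𝓘(ℝ, ℍ × ImH) 𝓘(ℝ, ImH × ImH) ksSigma p :=
    (contMDiff_ksSigma p).mdifferentiableAt (by simp)
  have h1 := pullback_comp (q := p) (g := ksChart) (f := proj) (I := 𝓘(ℝ, ℍ × ImH))
    (constForm omegaIm) ((contMDiff_ksQuot (proj p)).mdifferentiableAt (by simp))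
    ((contMDiff_proj p).mdifferentiableAt (by simp))
  have h2 : mfderiv 𝓘(ℝ, ℍ × ImH) 𝓘(ℝ, ℍ × ℍ) (ksMap ∘ (Subtype.val : Sigma1 → ℍ × ℍ)) p =
      inclH ∘L mfderiv 𝓘(ℝ, ℍ × ImH) 𝓘(ℝ, ImH × ImH) ksSigma p :=
    (inclH.hasFDerivAt.hasMFDerivAt.comp p hk.hasMFDerivAt).mfderiv
  rw [h1]
  simp only [pullback]
  rw [formH_eq, h2]
  rfl

/-- A 2-form on `V¹` is determined by its pullback to `Σ¹`, as the projection is a surjective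
submersion. -/
lemma IsReducedForm.unique {β β' : TwoForm 𝓘(ℝ, ImH × ImH) V1} (h : IsReducedForm β)
    (h' : IsReducedForm β') : β = β' := by
  funext q
  obtain ⟨p, rfl⟩ := proj_surjective q
  ext v
  choose u hu using fun i => surjective_mfderiv_proj p (v i)
  have h1 := congrArg (fun γ : TwoForm 𝓘(ℝ, ℍ × ImH) Sigma1 => γ p u) (Eq.trans h h'.symm)
  have h2 : v = fun i => mfderiv 𝓘(ℝ, ℍ × ImH) 𝓘(ℝ, ImH × ImH) proj p (u i) :=
    funext fun i => (hu i).symm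
  rw [h2]
  exact h1

end KS

end

theorem mainTheorem2 :
    -- `Σ¹` is an embedded smooth hypersurface of `T^*ℍ`
    Manifold.IsSmoothEmbedding 𝓘(ℝ, ℍ × ImH) 𝓘(ℝ, ℍ × ℍ) ∞ (Subtype.val : Sigma1 → ℍ × ℍ) ∧
    -- `V¹` is a smooth manifold and the projection `Σ¹ → V¹` is a smooth submersion
    IsManifold 𝓘(ℝ, ImH × ImH) ∞ V1 ∧
    ContMDiff 𝓘(ℝ, ℍ × ImH) 𝓘(ℝ, ImH × ImH) ∞ proj ∧
    (∀ p : Sigma1, Function.Surjective (mfderiv 𝓘(ℝ, ℍ × ImH) 𝓘(ℝ, ImH × ImH) proj p)) ∧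
    -- the identity `K.S.^* Re {dP̄ ∧ dQ} = Re {dw̄ ∧ dz}` on `Σ¹`
    pullback 𝓘(ℝ, ℍ × ImH) 𝓘(ℝ, ℍ × ℍ) (Subtype.val : Sigma1 → ℍ × ℍ)
        (pullback 𝓘(ℝ, ℍ × ℍ) 𝓘(ℝ, ℍ × ℍ) ksMap formH) = formSigma ∧
    -- the target is a symplectic manifold, and so is the reduced space with its unique reduced form
    IsSymplectic formTStar ∧
    ∃ ω₁ : TwoForm 𝓘(ℝ, ImH × ImH) V1,
      IsReducedForm ω₁ ∧ (∀ β, IsReducedForm β → β = ω₁) ∧ IsSymplectic ω₁ ∧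
      -- the Kustaanheimo-Stiefel mapping induces a symplectomorphism
      ∃ Φ : V1 ≃ₘ^∞⟮𝓘(ℝ, ImH × ImH), 𝓘(ℝ, ImH × ImH)⟯ TStar,
        (∀ p : Sigma1, (coordQ (Φ (proj p)), coordP (Φ (proj p))) = ksMap p) ∧
        pullback 𝓘(ℝ, ImH × ImH) 𝓘(ℝ, ImH × ImH) Φ formTStar = ω₁ := by
  refine ⟨isSmoothEmbedding_subtypeVal, isManifold_V1, contMDiff_proj, surjective_mfderiv_proj,
    pullback_pullback_ksMap, isSymplectic_formTStar, _, isReducedForm_pullback_ksChart,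
    fun β hβ => hβ.unique isReducedForm_pullback_ksChart,
    isSymplectic_pullback_constForm ksChart_mem_atlas rfl omegaIm_nondegenerate,
    ksDiffeo, coe_ksSigma, pullback_ksDiffeo_formTStar⟩
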